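/- Let $G$ be a (finite-dimensional, Hausdorff, second countable) real Lie group with Lie algebra $\mathfrak g=T_eG$, and let $M$ be a homogeneous $G$-space, that is, a (finite-dimensional, Hausdorff, second countable) smooth manifold without boundary with a smooth transitive left action $G\times M\to M$, $(a,x)\mapsto a.x$. For $v\in\mathfrak g$ let $\exp(v)=\gamma(1)$, where $\gamma:\mathbb R\to G$ is the unique one-parameter subgroup with $\dot\gamma(0)=v$, and define the vector field $\widetilde v$ on $M$ by $$\widetilde v_x=\frac{d}{dt}\Big|_{t=0}\exp(tv).x,\qquad x\in M.$$ Let $\{v_i\}_{i=1}^m$ be any basis of $\mathfrak g$ ($m\ge 0$). Then the curves $t\mapsto\exp(tv_i).x$ are differentiable at $t=0$ for all $i$ and all $x\in M$, the vector fields $\widetilde v_1,\dots,\widetilde v_m$ are smooth, and they form a generating set of the $C^\infty(M)$-module of smooth vector fields on $M$: for every smooth vector field $X$ on $M$ there are functions $f_1,\dots,f_m\in C^\infty(M)$ with $$X=f_1\widetilde v_1+\cdots+f_m\widetilde v_m .$$ (For $m=0$ this says that the only vector field on $M$ is $0$.) -/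

import Mathlib

open scoped Manifold ContDiff

noncomputable section

/-- `γ : ℝ → G` is a one-parameter subgroup of the Lie group `G` (a smooth group homomorphism
from `(ℝ, +)` to `G`) with initial velocity `γ'(0) = v` in `𝔤 = T₁G`. The vector `γ'(0)` has the
type `TangentSpace I (γ 0)`, which is the tangent space at `1` because `γ 0 = 1`. -/
structure IsOneParameterSubgroup {E : Type*} [NormedAddCommGroup E] [NormedSpace ℝ E]
    {H : Type*} [TopologicalSpace H] (I : ModelWithCorners ℝ E H)
    {G : Type*} [TopologicalSpace G] [ChartedSpace H G] [Group G]
    (γ : ℝ → G) (v : GroupLieAlgebra I G) : Prop where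
  map_zero : γ 0 = 1
  map_add : ∀ s t : ℝ, γ (s + t) = γ s * γ t
  smooth : ContMDiff 𝓘(ℝ, ℝ) I ∞ γ
  velocity : mfderiv 𝓘(ℝ, ℝ) I γ 0 (1 : ℝ) = v

open Classical in
/-- The exponential map of a Lie group: `exp v = γ 1`, where `γ` is the one-parameter subgroup
with `γ'(0) = v`. (In a finite-dimensional Lie group there is exactly one such `γ`, so the value
`1` of the other branch is never used.) -/
def lieExp {E : Type*} [NormedAddCommGroup E] [NormedSpace ℝ E]
    {H : Type*} [TopologicalSpace H] (I : ModelWithCorners ℝ E H)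
    {G : Type*} [TopologicalSpace G] [ChartedSpace H G] [Group G]
    (v : GroupLieAlgebra I G) : G :=
  if h : ∃ γ : ℝ → G, IsOneParameterSubgroup I γ v then h.choose 1 else 1

/-- The vector field on `M` induced by `v ∈ 𝔤` through the infinitesimal action:
its value at `x` is `d/dt|_{t=0} exp(tv) • x`. This derivative is based at `exp(0) • x = x`. -/
def infinitesimalAction {E : Type*} [NormedAddCommGroup E] [NormedSpace ℝ E]
    {H : Type*} [TopologicalSpace H] (I : ModelWithCorners ℝ E H)
    {E' : Type*} [NormedAddCommGroup E'] [NormedSpace ℝ E']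
    {H' : Type*} [TopologicalSpace H'] (I' : ModelWithCorners ℝ E' H')
    {G : Type*} [TopologicalSpace G] [ChartedSpace H G] [Group G]
    {M : Type*} [TopologicalSpace M] [ChartedSpace H' M] [MulAction G M]
    (v : GroupLieAlgebra I G) (x : M) : TangentSpace I' x :=
  mfderiv 𝓘(ℝ, ℝ) I' (fun t : ℝ => lieExp I (t • v) • x) 0 (1 : ℝ)

/-- A vector field on `M` is smooth if it is smooth as a section of the tangent bundle. -/
def IsSmoothVectorField {E : Type*} [NormedAddCommGroup E] [NormedSpace ℝ E]
    {H : Type*} [TopologicalSpace H] (I : ModelWithCorners ℝ E H)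
    {M : Type*} [TopologicalSpace M] [ChartedSpace H M] [IsManifold I ∞ M]
    (X : ∀ x : M, TangentSpace I x) : Prop :=
  ContMDiff I I.tangent ∞ (fun x => (⟨x, X x⟩ : TangentBundle I M))

/-- The finite family `X` of vector fields is a generating set of the `C^∞(M)`-module of smooth
vector fields: its members are smooth, and every smooth vector field is a linear combination of
them with coefficients in `C^∞(M)`. -/
def IsGeneratingSet {E : Type*} [NormedAddCommGroup E] [NormedSpace ℝ E]
    {H : Type*} [TopologicalSpace H] (I : ModelWithCorners ℝ E H)
    {M : Type*} [TopologicalSpace M] [ChartedSpace H M] [IsManifold I ∞ M]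
    {m : ℕ} (X : Fin m → ∀ x : M, TangentSpace I x) : Prop :=
  (∀ i, IsSmoothVectorField I (X i)) ∧
    ∀ Y : ∀ x : M, TangentSpace I x, IsSmoothVectorField I Y →
      ∃ f : Fin m → M → ℝ, (∀ i, ContMDiff I 𝓘(ℝ, ℝ) ∞ (f i)) ∧
        ∀ x : M, Y x = ∑ i, f i x • X i x

end

open Set Bundle Topology Module

theorem tangentBundle_mk_congr {E : Type*} [NormedAddCommGroup E] [NormedSpace ℝ E]
    {H : Type*} [TopologicalSpace H] (I : ModelWithCorners ℝ E H)
    {M : Type*} [TopologicalSpace M] [ChartedSpace H M] {p q : M} (h : p = q) (w : E) :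
    (TotalSpace.mk (F := E) (E := TangentSpace I) p w) =
      TotalSpace.mk (F := E) (E := TangentSpace I) q w := by
  subst h
  rfl

section VectorFields

variable {E : Type*} [NormedAddCommGroup E] [NormedSpace ℝ E]
  {H : Type*} [TopologicalSpace H] {I : ModelWithCorners ℝ E H}
  {E' : Type*} [NormedAddCommGroup E'] [NormedSpace ℝ E']
  {H' : Type*} [TopologicalSpace H'] {I' : ModelWithCorners ℝ E' H'}
  {E'' : Type*} [NormedAddCommGroup E''] [NormedSpace ℝ E'']
  {H'' : Type*} [TopologicalSpace H''] {I'' : ModelWithCorners ℝ E'' H''}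
  {N : Type*} [TopologicalSpace N] [ChartedSpace H N] [IsManifold I ∞ N]
  {M : Type*} [TopologicalSpace M] [ChartedSpace H' M] [IsManifold I' ∞ M]
  {P : Type*} [TopologicalSpace P] [ChartedSpace H'' P] [IsManifold I'' ∞ P]

/-- The derivative of a smooth function of two variables with respect to the first variable, in a
fixed direction, depends smoothly on the second variable. -/
theorem contMDiff_mfderiv_partial_left {F : N × M → P} (hF : ContMDiff (I.prod I') I'' ∞ F)
    (a : N) (v : TangentSpace I a) :
    ContMDiff I' I''.tangent ∞ (fun x : M =>
      (⟨F (a, x), mfderiv I I'' (fun y => F (y, x)) a v⟩ : TangentBundle I'' P)) := by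
  let f0 : M → TangentBundle I' M := fun g => TotalSpace.mk' E' g 0
  have s0 : ContMDiff I' I'.tangent ∞ f0 := contMDiff_zeroSection _ _
  let fv : M → TangentBundle I N := fun _ => TotalSpace.mk' E a v
  have sv : ContMDiff I' I.tangent ∞ fv := contMDiff_const
  let F₁ : M → (TangentBundle I N × TangentBundle I' M) := fun g => (fv g, f0 g)
  have S₁ : ContMDiff I' (I.tangent.prod I'.tangent) ∞ F₁ := sv.prodMk s0
  let F₂ : (TangentBundle I N × TangentBundle I' M) → TangentBundle (I.prod I') (N × M) :=
    (equivTangentBundleProd I N I' M).symm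
  have S₂ : ContMDiff (I.tangent.prod I'.tangent) (I.prod I').tangent ∞ F₂ :=
    contMDiff_equivTangentBundleProd_symm
  have S₃ : ContMDiff (I.prod I').tangent I''.tangent ∞ (tangentMap (I.prod I') I'' F) :=
    ContMDiff.contMDiff_tangentMap hF (m := ∞) (by simp)
  have S := (S₃.comp S₂).comp S₁
  convert! S with x
  simp only [Function.comp_apply, tangentMap, F₂, F₁, f0, fv]
  rw [mfderiv_prod_eq_add_apply (hF.mdifferentiableAt (by simp))]
  simp +instances
  let A : E →L[ℝ] E'' := mfderiv I I'' (fun y => F (y, x)) a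
  let B : E' →L[ℝ] E'' := mfderiv I' I'' (fun y => F (a, y)) x
  change A v = A v + B 0
  rw [B.map_zero, add_zero]

end VectorFields

section Groups

variable {E : Type*} [NormedAddCommGroup E] [NormedSpace ℝ E]
  {H : Type*} [TopologicalSpace H] {I : ModelWithCorners ℝ E H}
  {G : Type*} [TopologicalSpace G] [ChartedSpace H G] [Group G] [LieGroup I ∞ G]

theorem contMDiff_infty_mulInvariantVectorField (v : GroupLieAlgebra I G) :
    ContMDiff I I.tangent ∞
      (fun g : G => (⟨g, mulInvariantVectorField v g⟩ : TangentBundle I G)) := by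
  have hF : ContMDiff (I.prod I) I ∞ (fun p : G × G => p.2 * p.1) :=
    contMDiff_snd.mul contMDiff_fst
  have := contMDiff_mfderiv_partial_left hF 1 v
  convert! this using 2 with g
  exact tangentBundle_mk_congr I (mul_one g).symm _

theorem mfderiv_mul_left_mulInvariantVectorField (v : GroupLieAlgebra I G) (g h : G) :
    (mfderiv I I (g * ·) h (mulInvariantVectorField v h) : E) =
      mulInvariantVectorField v (g * h) := by
  have hl : ∀ (a b : G), MDifferentiableAt I I (a * ·) b := fun a b =>
    (contMDiff_mul_left (n := ∞)).mdifferentiableAt (by simp)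
  have h1 : HasMFDerivAt I I (h * ·) (1 : G) (mfderiv I I (h * ·) (1 : G)) :=
    (hl h 1).hasMFDerivAt
  have h2 : HasMFDerivAt I I (g * ·) (h * 1) (mfderiv I I (g * ·) (h * 1)) :=
    (hl g (h * 1)).hasMFDerivAt
  have h3 := (h2.comp (1 : G) h1).mfderiv
  have e : ((g * ·) ∘ (h * ·)) = (fun x : G => g * h * x) := by ext; simp [mul_assoc]
  rw [e] at h3
  have h4 : ∀ (k : G) (_ : k = h) (w : E),
      (mfderiv I I (g * ·) k : E →L[ℝ] E) w = (mfderiv I I (g * ·) h : E →L[ℝ] E) w := by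
    rintro k rfl w
    rfl
  unfold mulInvariantVectorField
  rw [h3]
  exact (h4 (h * 1) (mul_one h) _).symm

theorem IsMIntegralCurveOn.mul_left {γ : ℝ → G} {v : GroupLieAlgebra I G} {s : Set ℝ}
    (hγ : IsMIntegralCurveOn γ (mulInvariantVectorField v) s) (g : G) :
    IsMIntegralCurveOn (fun t => g * γ t) (mulInvariantVectorField v) s := by
  intro t ht
  have h1 : HasMFDerivAt I I (g * ·) (γ t) (mfderiv I I (g * ·) (γ t)) :=
    ((contMDiff_mul_left (n := ∞)).mdifferentiableAt (by simp)).hasMFDerivAt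
  refine (h1.comp_hasMFDerivWithinAt t (hγ t ht)).congr_mfderiv ?_
  refine ContinuousLinearMap.ext fun r => ?_
  have := mfderiv_mul_left_mulInvariantVectorField v g (γ t)
  let A : E →L[ℝ] E := mfderiv I I (g * ·) (γ t)
  let c : ℝ := r
  let w : E := mulInvariantVectorField v (γ t)
  let w' : E := mulInvariantVectorField v (g * γ t)
  change A w = w' at this
  change A (c • w) = c • w'
  rw [A.map_smul, this]

theorem IsMIntegralCurve.mul_left {γ : ℝ → G} {v : GroupLieAlgebra I G}
    (hγ : IsMIntegralCurve γ (mulInvariantVectorField v)) (g : G) :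
    IsMIntegralCurve (fun t => g * γ t) (mulInvariantVectorField v) := by
  rw [isMIntegralCurve_iff_isMIntegralCurveOn] at hγ ⊢
  exact hγ.mul_left g

/-- Left-invariant vector fields on a Lie group are complete. -/
theorem exists_isMIntegralCurve_mulInvariantVectorField [CompleteSpace E] [BoundarylessManifold I G]
    [T2Space G] (v : GroupLieAlgebra I G) :
    ∃ γ : ℝ → G, γ 0 = 1 ∧ IsMIntegralCurve γ (mulInvariantVectorField v) := by
  have : IsManifold I 1 G := IsManifold.of_le (n := ∞) (by simp)
  have hv := (contMDiff_infty_mulInvariantVectorField v).of_le (m := 1) (by simp)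
  obtain ⟨γ, h0, hγ⟩ := exists_isMIntegralCurveAt_of_contMDiffAt_boundaryless (t₀ := 0)
    (hv.contMDiffAt (x := 1))
  obtain ⟨ε, hε, hγ⟩ := isMIntegralCurveAt_iff'.1 hγ
  rw [Real.ball_eq_Ioo, zero_sub, zero_add] at hγ
  exact exists_isMIntegralCurve_of_isMIntegralCurveOn hv hε
    (fun g => ⟨fun t => g * γ t, by simp [h0], hγ.mul_left g⟩) 1

/-- Integral curves of smooth vector fields are smooth. -/
theorem IsMIntegralCurve.contMDiff {E : Type*} [NormedAddCommGroup E] [NormedSpace ℝ E]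
    {H : Type*} [TopologicalSpace H] {I : ModelWithCorners ℝ E H}
    {M : Type*} [TopologicalSpace M] [ChartedSpace H M] [IsManifold I ∞ M]
    {X : ∀ x : M, TangentSpace I x}
    (hX : ContMDiff I I.tangent ∞ (fun x => (⟨x, X x⟩ : TangentBundle I M)))
    {γ : ℝ → M} (hγ : IsMIntegralCurve γ X) : ContMDiff 𝓘(ℝ, ℝ) I ∞ γ := by
  have : IsManifold I 1 M := IsManifold.of_le (n := ∞) (by simp)
  rw [contMDiff_infty]
  intro n
  induction n with
  | zero => exact contMDiff_zero_iff.2 hγ.continuous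
  | succ n ih =>
    intro t₀
    rw [contMDiffAt_iff_target]
    refine ⟨hγ.continuous.continuousAt, ?_⟩
    rw [contMDiffAt_iff_contDiffAt]
    have hsec : ContMDiff 𝓘(ℝ, ℝ) I.tangent n
        (fun t => (⟨γ t, X (γ t)⟩ : TangentBundle I M)) :=
      (hX.of_le (by exact_mod_cast le_top)).comp ih
    have h2 := ((contMDiffAt_totalSpace).1 (hsec t₀)).2
    have h3 := (hγ.isMIntegralCurveAt t₀).eventually_hasDerivAt
    rw [contMDiffAt_iff_contDiffAt] at h2
    push_cast
    rw [contDiffAt_succ_iff_hasFDerivAt]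
    refine ⟨fun t => ContinuousLinearMap.toSpanSingleton ℝ
      (tangentCoordChange I (γ t) (γ t₀) (γ t) (X (γ t))), ⟨_, h3, fun t ht => ht.hasFDerivAt⟩, ?_⟩
    refine ((ContinuousLinearMap.toSpanSingletonCLE (𝕜 := ℝ) (E := E)).contDiff.contDiffAt).comp t₀ ?_
    exact h2

theorem IsMIntegralCurve.isOneParameterSubgroup [BoundarylessManifold I G]
    [T2Space G] {v : GroupLieAlgebra I G} {γ : ℝ → G} (h0 : γ 0 = 1)
    (hγ : IsMIntegralCurve γ (mulInvariantVectorField v)) : IsOneParameterSubgroup I γ v := by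
  have : IsManifold I 1 G := IsManifold.of_le (n := ∞) (by simp)
  have hv := (contMDiff_infty_mulInvariantVectorField v)
  refine ⟨h0, fun s t => ?_, hγ.contMDiff hv, ?_⟩
  · have := isMIntegralCurve_Ioo_eq_of_contMDiff_boundaryless (t₀ := 0) (hv.of_le (by simp))
      (hγ.comp_add s) (hγ.mul_left (γ s)) (by simp [h0])
    simpa [add_comm] using congrFun this t
  · rw [(hγ 0).mfderiv]
    have h1 : ∀ (k : G) (_ : k = 1), (mulInvariantVectorField v k : E) = v := by
      rintro k rfl
      have h2 : ∀ f : G → G, f = id → (mfderiv I I f 1 : E →L[ℝ] E) v = v := by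
        rintro _ rfl
        exact congrArg (fun A : E →L[ℝ] E => A v) (mfderiv_id (I := I) (x := (1 : G)))
      exact h2 (1 * ·) (funext one_mul)
    exact (one_smul ℝ (mulInvariantVectorField v (γ 0) : E)).trans (h1 _ h0)

theorem IsOneParameterSubgroup.isMIntegralCurve {v : GroupLieAlgebra I G} {γ : ℝ → G}
    (hγ : IsOneParameterSubgroup I γ v) : IsMIntegralCurve γ (mulInvariantVectorField v) := by
  intro s
  have h0 : HasMFDerivAt 𝓘(ℝ, ℝ) I γ (s - s) (mfderiv 𝓘(ℝ, ℝ) I γ (s - s)) :=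
    (hγ.smooth.mdifferentiableAt (by simp)).hasMFDerivAt
  have hsub : HasMFDerivAt 𝓘(ℝ, ℝ) 𝓘(ℝ, ℝ) (fun t : ℝ => t - s) s
      (ContinuousLinearMap.id ℝ ℝ) :=
    ((hasFDerivAt_id s).sub_const s).hasMFDerivAt
  have h1 : HasMFDerivAt I I (γ s * ·) (γ (s - s)) (mfderiv I I (γ s * ·) (γ (s - s))) :=
    ((contMDiff_mul_left (n := ∞)).mdifferentiableAt (by simp)).hasMFDerivAt
  have h2 := h1.comp s (HasMFDerivAt.comp (g := γ) (f := fun t : ℝ => t - s) s h0 hsub)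
  have e : (γ s * ·) ∘ γ ∘ (fun t : ℝ => t - s) = γ := by
    ext t
    simp [← hγ.map_add]
  rw [e] at h2
  refine h2.congr_mfderiv ?_
  have key : ∀ (r : ℝ) (k : G), r = 0 → k = 1 →
      ((mfderiv I I (γ s * ·) k : E →L[ℝ] E).comp (mfderiv 𝓘(ℝ, ℝ) I γ r : ℝ →L[ℝ] E)) =
        ContinuousLinearMap.smulRight (1 : ℝ →L[ℝ] ℝ) (mulInvariantVectorField v (γ s) : E) := by
    rintro r k rfl rfl
    refine ContinuousLinearMap.ext_ring ?_
    let A : E →L[ℝ] E := mfderiv I I (γ s * ·) 1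
    have hv : (mfderiv 𝓘(ℝ, ℝ) I γ 0 : ℝ →L[ℝ] E) (1 : ℝ) = v := hγ.velocity
    exact (congrArg A hv).trans (one_smul ℝ (mulInvariantVectorField v (γ s) : E)).symm
  exact key (s - s) (γ (s - s)) (sub_self s) (by rw [sub_self, hγ.map_zero])

/-- A Lie algebra element generates exactly one one-parameter subgroup, and the exponential map
reads it off. -/
theorem IsOneParameterSubgroup.lieExp_smul [BoundarylessManifold I G]
    [T2Space G] {v : GroupLieAlgebra I G} {γ : ℝ → G}
    (hγ : IsOneParameterSubgroup I γ v) (t : ℝ) : lieExp I (t • v) = γ t := by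
  have : IsManifold I 1 G := IsManifold.of_le (n := ∞) (by simp)
  have h1 : IsOneParameterSubgroup I (fun s => γ (s * t)) (t • v) := by
    apply IsMIntegralCurve.isOneParameterSubgroup (by simp [hγ.map_zero])
    rw [mulInvariantVectorField_smul]
    exact hγ.isMIntegralCurve.comp_mul t
  have h2 : ∃ γ : ℝ → G, IsOneParameterSubgroup I γ (t • v) := ⟨_, h1⟩
  rw [lieExp, dif_pos h2]
  have := isMIntegralCurve_Ioo_eq_of_contMDiff_boundaryless (t₀ := 0)
    ((contMDiff_infty_mulInvariantVectorField (t • v)).of_le (by simp))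
    h2.choose_spec.isMIntegralCurve h1.isMIntegralCurve
    (by rw [h2.choose_spec.map_zero, h1.map_zero])
  simpa using congrFun this 1

end Groups

section ConstantRank

/-- Every linear map between vector spaces has a reflexive generalized inverse. -/
theorem LinearMap.exists_generalizedInverse {K V W : Type*} [DivisionRing K] [AddCommGroup V]
    [Module K V] [AddCommGroup W] [Module K W] (A : V →ₗ[K] W) :
    ∃ T : W →ₗ[K] V, (∀ x, A (T (A x)) = A x) ∧ ∀ y, T (A (T y)) = T y := by
  obtain ⟨S, hS⟩ := Submodule.exists_isCompl (LinearMap.ker A)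
  obtain ⟨g, hg⟩ := LinearMap.exists_leftInverse_of_injective (A ∘ₗ S.subtype) (by
    rw [LinearMap.ker_eq_bot']
    intro s hs
    have : (s : V) ∈ LinearMap.ker A ⊓ S := ⟨hs, s.2⟩
    rw [hS.inf_eq_bot] at this
    exact Subtype.ext this)
  have hg' : ∀ s : S, g (A s) = s := fun s => LinearMap.congr_fun hg s
  refine ⟨S.subtype ∘ₗ g, fun x => ?_, fun y => ?_⟩
  · obtain ⟨k, hk, s, hs, rfl⟩ := Submodule.mem_sup.1 (hS.sup_eq_top ▸ Submodule.mem_top (x := x))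
    have := hg' ⟨s, hs⟩
    simp only [LinearMap.mem_ker] at hk
    simp only [map_add, hk, zero_add, LinearMap.comp_apply, Submodule.subtype_apply] at this ⊢
    rw [this]
  · simp [hg']

variable {E F : Type*} [NormedAddCommGroup E] [NormedSpace ℝ E] [FiniteDimensional ℝ E]
  [NormedAddCommGroup F] [NormedSpace ℝ F] [FiniteDimensional ℝ F]

theorem dimH_submodule_coe (S : Submodule ℝ E) : dimH (S : Set E) = finrank ℝ S := by
  rw [← Real.dimH_univ_eq_finrank S, ← S.subtypeₗᵢ.isometry.dimH_image univ]
  simp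

/-- The image of a map of class `C¹` near a point where its rank is maximal has Hausdorff dimension
at most the rank. -/
theorem ContDiffAt.exists_mem_nhds_dimH_image_le {f : E → F} {a : E} (hf : ContDiffAt ℝ 1 f a)
    (hr : ∀ᶠ x in 𝓝 a, finrank ℝ (fderiv ℝ f x).range ≤ finrank ℝ (fderiv ℝ f a).range) :
    ∃ U ∈ 𝓝 a, dimH (f '' U) ≤ finrank ℝ (fderiv ℝ f a).range := by
  have : CompleteSpace E := FiniteDimensional.complete ℝ E
  set A := fderiv ℝ f a with hA
  obtain ⟨T₀, h1, h2⟩ := LinearMap.exists_generalizedInverse (A : E →ₗ[ℝ] F)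
  let T : F →L[ℝ] E := LinearMap.toContinuousLinearMap T₀
  replace h1 : ∀ x, A (T (A x)) = A x := h1
  replace h2 : ∀ y, T (A (T y)) = T y := h2
  let P : E →L[ℝ] E := T.comp A
  have hP : ∀ x, P x = T (A x) := fun _ => rfl
  have hker : ∀ x, P x = 0 ↔ A x = 0 := fun x =>
    ⟨fun h => by rw [← h1, ← hP, h, map_zero], fun h => by rw [hP, h, map_zero]⟩
  have hPrank : finrank ℝ P.range = finrank ℝ A.range := by
    have e : P.ker = A.ker := by ext x; simpa using hker x
    have e1 := LinearMap.finrank_range_add_finrank_ker (P : E →ₗ[ℝ] E)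
    have e2 := LinearMap.finrank_range_add_finrank_ker (A : E →ₗ[ℝ] F)
    rw [e] at e1
    omega
  let Φ : E → E := fun x => T (f x) + (x - P x)
  have hΦ' : ∀ x, DifferentiableAt ℝ f x → HasFDerivAt Φ
      (T.comp (fderiv ℝ f x) + (ContinuousLinearMap.id ℝ E - P)) x := fun x hx =>
    (T.hasFDerivAt.comp x hx.hasFDerivAt).add ((hasFDerivAt_id x).sub P.hasFDerivAt)
  have hΦa : HasFDerivAt Φ ((ContinuousLinearEquiv.refl ℝ E : E ≃L[ℝ] E) : E →L[ℝ] E) a := by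
    convert hΦ' a (hf.differentiableAt (by simp)) using 1
    ext x
    simp [P, ← hA]
  have hΦ : ContDiffAt ℝ 1 Φ a :=
    (T.contDiff.contDiffAt.comp a hf).add (contDiffAt_id.sub P.contDiff.contDiffAt)
  have hev : ∀ᶠ x in 𝓝 a, ContDiffAt ℝ 1 f x ∧
      ∀ e, T (fderiv ℝ f x e) = 0 → fderiv ℝ f x e = 0 := by
    have hcont : ContinuousAt (fun x => T.comp (fderiv ℝ f x) + (ContinuousLinearMap.id ℝ E - P)) a := by
      have := hf.continuousAt_fderiv (by simp)
      fun_prop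
    have hunit : ∀ᶠ x in 𝓝 a, IsUnit (T.comp (fderiv ℝ f x) + (ContinuousLinearMap.id ℝ E - P)) := by
      refine hcont.eventually (IsOpen.mem_nhds Units.isOpen ?_)
      refine ⟨1, ?_⟩
      ext x
      simp [P, ← hA]
    filter_upwards [hf.eventually (by simp), hr, hunit] with x hx hrx hux
    refine ⟨hx, fun e he => ?_⟩
    set B := fderiv ℝ f x
    have hsurj : (⊤ : Submodule ℝ E) ≤ (T.comp B).range ⊔ (ContinuousLinearMap.id ℝ E - P).range := by
      obtain ⟨u, hu⟩ := hux
      intro y _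
      have : (u : E →L[ℝ] E) ((↑u⁻¹ : E →L[ℝ] E) y) = y :=
        DFunLike.congr_fun u.mul_inv y
      rw [hu] at this
      rw [← this]
      exact Submodule.add_mem_sup ⟨_, rfl⟩ ⟨_, rfl⟩
    have d1 := Submodule.finrank_mono hsurj
    have d2 := Submodule.finrank_add_le_finrank_add_finrank (T.comp B).range
      (ContinuousLinearMap.id ℝ E - P).range
    have d3 : finrank ℝ (ContinuousLinearMap.id ℝ E - P).range ≤ finrank ℝ P.ker := by
      apply Submodule.finrank_mono
      rintro _ ⟨y, rfl⟩
      simp [P, h2]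
    have d4 := LinearMap.finrank_range_add_finrank_ker (P : E →ₗ[ℝ] E)
    have d5 := LinearMap.finrank_range_add_finrank_ker (B : E →ₗ[ℝ] F)
    have d6 := LinearMap.finrank_range_add_finrank_ker ((T.comp B : E →L[ℝ] E) : E →ₗ[ℝ] E)
    have hle : B.ker ≤ (T.comp B).ker := by
      intro y hy
      have : B y = 0 := hy
      simp [this]
    rw [finrank_top] at d1
    have := Submodule.eq_of_le_of_finrank_le hle (by omega)
    have hm : e ∈ (T.comp B).ker := he
    rw [← this] at hm
    exact hm
  let Ψ := hΦ.toOpenPartialHomeomorph Φ hΦa (by simp)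
  have haS : a ∈ Ψ.source := hΦ.mem_toOpenPartialHomeomorph_source hΦa (by simp)
  have hΨ : ∀ x, Ψ x = Φ x := fun _ => rfl
  have hψ : ContDiffAt ℝ 1 Ψ.symm (Φ a) := hΦ.to_localInverse hΦa (by simp)
  have hψa : Ψ.symm (Φ a) = a := Ψ.left_inv haS
  obtain ⟨ε, hε, hball⟩ := Metric.eventually_nhds_iff_ball.1
    ((hψ.eventually (by simp)).and
      ((Filter.eventually_of_mem (Ψ.open_target.mem_nhds (Ψ.map_source haS)) fun y hy => hy).and
      (hψ.continuousAt.eventually (hψa.symm ▸ hev))))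
  have hfψ : ∀ y ∈ Metric.ball (Φ a) ε, ContDiffAt ℝ 1 (f ∘ Ψ.symm) y := fun y hy =>
    (hball y hy).2.2.1.comp y (hball y hy).1
  have hTf : ∀ y ∈ Metric.ball (Φ a) ε, T (f (Ψ.symm y)) = P y := by
    intro y hy
    have e1 : T (f (Ψ.symm y)) + (Ψ.symm y - P (Ψ.symm y)) = y := Ψ.right_inv (hball y hy).2.1
    have e2 := congrArg P e1
    simpa [P, h1, h2] using e2
  have hder : ∀ y ∈ Metric.ball (Φ a) ε, ∀ k, P k = 0 → fderiv ℝ (f ∘ Ψ.symm) y k = 0 := by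
    intro y hy k hk
    have e1 : HasFDerivAt (T ∘ (f ∘ Ψ.symm)) (T.comp (fderiv ℝ (f ∘ Ψ.symm) y)) y :=
      T.hasFDerivAt.comp y ((hfψ y hy).differentiableAt (by simp)).hasFDerivAt
    have e2 : HasFDerivAt (T ∘ (f ∘ Ψ.symm)) P y :=
      P.hasFDerivAt.congr_of_eventuallyEq
        (Filter.eventually_of_mem (Metric.isOpen_ball.mem_nhds hy) hTf)
    have e3 : T (fderiv ℝ (f ∘ Ψ.symm) y k) = 0 := by
      rw [← hk]; exact DFunLike.congr_fun (e1.unique e2) k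
    have hd := (((hball y hy).2.2.1.differentiableAt (by simp)).hasFDerivAt.comp y
      ((hball y hy).1.differentiableAt (by simp)).hasFDerivAt).fderiv
    rw [hd] at e3 ⊢
    exact (hball y hy).2.2.2 _ e3
  have hconst : ∀ y ∈ Metric.ball (Φ a) ε, ∀ z ∈ Metric.ball (Φ a) ε, P (z - y) = 0 →
      f (Ψ.symm z) = f (Ψ.symm y) := by
    intro y hy z hz hyz
    have hmem : ∀ t ∈ Icc (0 : ℝ) 1, y + t • (z - y) ∈ Metric.ball (Φ a) ε := fun t ht =>
      (convex_ball _ _).add_smul_sub_mem hy hz ht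
    have hd : ∀ t ∈ Icc (0 : ℝ) 1, HasDerivAt (fun t : ℝ => f (Ψ.symm (y + t • (z - y)))) 0 t := by
      intro t ht
      have e1 : HasDerivAt (fun t : ℝ => y + t • (z - y)) (z - y) t := by
        simpa using ((hasDerivAt_id t).smul_const (z - y)).const_add y
      have := ((hfψ _ (hmem t ht)).differentiableAt (by simp)).hasFDerivAt.comp_hasDerivAt t e1
      rw [hder _ (hmem t ht) _ hyz] at this
      exact this
    have := constant_of_has_deriv_right_zero (fun t ht => (hd t ht).continuousAt.continuousWithinAt)
      (fun t ht => (hd t (Ico_subset_Icc_self ht)).hasDerivWithinAt) 1 (by simp)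
    simpa using this
  let δ : ℝ := ε / (‖P‖ + 1)
  have hδ : 0 < δ := by positivity
  have hδε : δ ≤ ε := div_le_self hε.le (by linarith [norm_nonneg P])
  refine ⟨Ψ.symm '' Metric.ball (Φ a) δ, ?_, ?_⟩
  · have := Ψ.symm.image_mem_nhds (Ψ.map_source haS) (Metric.ball_mem_nhds (Φ a) hδ)
    rwa [hΨ, hψa] at this
  let t : Set E := (fun w => Φ a + w) '' (P.range : Set E) ∩ Metric.ball (Φ a) ε
  have hsub : f '' (Ψ.symm '' Metric.ball (Φ a) δ) ⊆ (f ∘ Ψ.symm) '' t := by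
    rintro _ ⟨_, ⟨y, hy, rfl⟩, rfl⟩
    have hm : Φ a + P (y - Φ a) ∈ Metric.ball (Φ a) ε := by
      rw [mem_ball_iff_norm] at hy ⊢
      rw [add_sub_cancel_left]
      calc ‖P (y - Φ a)‖ ≤ ‖P‖ * ‖y - Φ a‖ := P.le_opNorm _
        _ ≤ (‖P‖ + 1) * ‖y - Φ a‖ := by gcongr; linarith
        _ < (‖P‖ + 1) * δ := by gcongr
        _ = ε := by simp only [δ]; field_simp
    refine ⟨_, ⟨⟨P (y - Φ a), ⟨_, rfl⟩, rfl⟩, hm⟩, ?_⟩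
    refine hconst y (Metric.ball_subset_ball hδε hy) _ hm ?_
    simp [P, h1]
  calc dimH (f '' (Ψ.symm '' Metric.ball (Φ a) δ)) ≤ dimH ((f ∘ Ψ.symm) '' t) := dimH_mono hsub
    _ ≤ dimH t := ContDiffOn.dimH_image_le (s := Metric.ball (Φ a) ε)
        (fun y hy => (hfψ y hy).contDiffWithinAt) (convex_ball _ _) inter_subset_right
    _ ≤ dimH ((fun w => Φ a + w) '' (P.range : Set E)) := dimH_mono inter_subset_left
    _ = dimH (P.range : Set E) := (isometry_add_left (Φ a)).dimH_image _
    _ = finrank ℝ A.range := by rw [dimH_submodule_coe, hPrank]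

end ConstantRank

section Manifolds

variable {E : Type*} [NormedAddCommGroup E] [NormedSpace ℝ E] [FiniteDimensional ℝ E]
  {H : Type*} [TopologicalSpace H] {I : ModelWithCorners ℝ E H} [I.Boundaryless]
  {E' : Type*} [NormedAddCommGroup E'] [NormedSpace ℝ E'] [FiniteDimensional ℝ E']
  {H' : Type*} [TopologicalSpace H'] {I' : ModelWithCorners ℝ E' H'} [I'.Boundaryless]
  {N : Type*} [TopologicalSpace N] [ChartedSpace H N] [IsManifold I ∞ N]
  {M : Type*} [TopologicalSpace M] [ChartedSpace H' M] [IsManifold I' ∞ M]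

/-- An open smooth map between manifolds is a submersion at each point where its rank is locally
maximal. -/
theorem IsOpenMap.mfderiv_surjective {φ : N → M} (hopen : IsOpenMap φ)
    (hφ : ContMDiff I I' ∞ φ) (p : N)
    (hrank : ∀ q, finrank ℝ (mfderiv I I' φ q : E →L[ℝ] E').range ≤
      finrank ℝ (mfderiv I I' φ p : E →L[ℝ] E').range) :
    Function.Surjective (mfderiv I I' φ p : E →L[ℝ] E') := by
  have : IsManifold I 1 N := IsManifold.of_le (n := ∞) (by simp)
  have : IsManifold I' 1 M := IsManifold.of_le (n := ∞) (by simp)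
  let f : E → E' := extChartAt I' (φ p) ∘ φ ∘ (extChartAt I p).symm
  let a : E := extChartAt I p p
  have hfa : fderiv ℝ f a = mfderiv I I' φ p := by
    let D : E →L[ℝ] E' := mfderiv I I' φ p
    have : HasFDerivWithinAt f D (range I) a :=
      ((hφ.mdifferentiableAt (x := p) (by simp)).hasMFDerivAt).2
    rw [I.range_eq_univ, hasFDerivWithinAt_univ] at this
    exact this.fderiv
  have hf : ContDiffAt ℝ 1 f a := by
    have := (contMDiffAt_iff.1 ((hφ.of_le (m := 1) (by simp)) p)).2
    rwa [I.range_eq_univ, contDiffWithinAt_univ] at this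
  have hlocal : ∀ᶠ y in 𝓝 a, y ∈ (extChartAt I p).target ∧
      φ ((extChartAt I p).symm y) ∈ (extChartAt I' (φ p)).source := by
    refine (Filter.eventually_of_mem (extChartAt_target_mem_nhds p) fun y hy => hy).and ?_
    have hc : ContinuousAt (φ ∘ (extChartAt I p).symm) a :=
      hφ.continuous.continuousAt.comp (continuousAt_extChartAt_symm p)
    apply hc.eventually
    simp only [Function.comp_apply, a, extChartAt_to_inv]
    exact extChartAt_source_mem_nhds (φ p)
  have hr : ∀ᶠ y in 𝓝 a, finrank ℝ (fderiv ℝ f y).range ≤ finrank ℝ (fderiv ℝ f a).range := by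
    filter_upwards [hlocal] with y ⟨hy, hy'⟩
    let q : N := (extChartAt I p).symm y
    have h1 : HasMFDerivAt 𝓘(ℝ, E) I (extChartAt I p).symm y
        (mfderiv 𝓘(ℝ, E) I (extChartAt I p).symm y) := by
      have := mdifferentiableWithinAt_extChartAt_symm hy
      rw [I.range_eq_univ, mdifferentiableWithinAt_univ] at this
      exact this.hasMFDerivAt
    have h2 : HasMFDerivAt I I' φ q (mfderiv I I' φ q) :=
      (hφ.mdifferentiableAt (by simp)).hasMFDerivAt
    have h3 : HasMFDerivAt I' 𝓘(ℝ, E') (extChartAt I' (φ p)) (φ q)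
        (mfderiv I' 𝓘(ℝ, E') (extChartAt I' (φ p)) (φ q)) :=
      (mdifferentiableAt_extChartAt (by rwa [← extChartAt_source I'])).hasMFDerivAt
    let A : E →L[ℝ] E := mfderiv 𝓘(ℝ, E) I (extChartAt I p).symm y
    let B : E →L[ℝ] E' := mfderiv I I' φ q
    let C : E' →L[ℝ] E' := mfderiv I' 𝓘(ℝ, E') (extChartAt I' (φ p)) (φ q)
    let D : E →L[ℝ] E' := C.comp (B.comp A)
    have h4 : HasMFDerivAt 𝓘(ℝ, E) 𝓘(ℝ, E') f y (D) :=
      HasMFDerivAt.comp (g := extChartAt I' (φ p)) y h3 (HasMFDerivAt.comp (g := φ) y h2 h1)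
    have h5 : HasFDerivWithinAt f D (range 𝓘(ℝ, E)) y := h4.2
    rw [ModelWithCorners.range_eq_univ, hasFDerivWithinAt_univ] at h5
    rw [h5.fderiv, hfa]
    refine le_trans ?_ (hrank q)
    change finrank ℝ ((C : E' →ₗ[ℝ] E') ∘ₗ ((B : E →ₗ[ℝ] E') ∘ₗ (A : E →ₗ[ℝ] E))).range ≤
      finrank ℝ (B : E →ₗ[ℝ] E').range
    rw [LinearMap.range_comp]
    exact (Submodule.finrank_map_le _ _).trans
      (Submodule.finrank_mono (LinearMap.range_comp_le_range _ _))
  obtain ⟨U, hU, hdim⟩ := hf.exists_mem_nhds_dimH_image_le hr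
  rw [hfa] at hdim
  let V : Set N := extChartAt I p ⁻¹' U ∩ (extChartAt I p).source ∩
    φ ⁻¹' (extChartAt I' (φ p)).source
  have hV : V ∈ 𝓝 p := Filter.inter_mem (Filter.inter_mem
    ((continuousAt_extChartAt p).preimage_mem_nhds hU) (extChartAt_source_mem_nhds p))
    (hφ.continuous.continuousAt.preimage_mem_nhds (extChartAt_source_mem_nhds (φ p)))
  have hW : extChartAt I' (φ p) '' (φ '' V) ∈ 𝓝 (extChartAt I' (φ p) (φ p)) :=
    extChartAt_image_nhds_mem_nhds_of_boundaryless (hopen.image_mem_nhds hV)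
  have hsub : extChartAt I' (φ p) '' (φ '' V) ⊆ f '' U := by
    rintro _ ⟨_, ⟨q, ⟨⟨hq, hq'⟩, -⟩, rfl⟩, rfl⟩
    exact ⟨_, hq, by simp only [f, Function.comp_apply, (extChartAt I p).left_inv hq']⟩
  have h1 := Real.dimH_of_mem_nhds hW
  have h2 : (finrank ℝ E' : ENNReal) ≤ finrank ℝ (mfderiv I I' φ p : E →L[ℝ] E').range :=
    h1 ▸ (dimH_mono hsub).trans hdim
  have h3 := Submodule.eq_top_of_finrank_eq
    (le_antisymm (Submodule.finrank_le _) (by exact_mod_cast h2))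
  exact LinearMap.range_eq_top.1 h3

variable {G : Type*} [TopologicalSpace G] [ChartedSpace H G] [Group G] [LieGroup I ∞ G]
  [MulAction G M] [ContMDiffSMul I I' ∞ G M]

omit [FiniteDimensional ℝ E] [FiniteDimensional ℝ E'] [I.Boundaryless] [I'.Boundaryless]
  [IsManifold I' ∞ M] [LieGroup I ∞ G] in
theorem contMDiff_smul_left (x : M) : ContMDiff I I' ∞ (fun g : G => g • x) :=
  contMDiff_id.smul contMDiff_const

theorem mfderiv_smul_left_surjective [SecondCountableTopology G] [T2Space M]
    [MulAction.IsPretransitive G M] (x : M) :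
    Function.Surjective (mfderiv I I' (fun g : G => g • x) (1 : G) : E →L[ℝ] E') := by
  have := topologicalGroup_of_lieGroup I ∞ (G := G)
  have : ContinuousSMul G M := ContMDiffSMul.continuousSMul (I := I) (I' := I') ∞
  have : LocallyCompactSpace M := Manifold.locallyCompact_of_finiteDimensional I'
  have : LocallyCompactSpace G := Manifold.locallyCompact_of_finiteDimensional I
  have hopen : IsOpenMap (fun g : G => g • x) := isOpenMap_smul_of_sigmaCompact x
  refine hopen.mfderiv_surjective (contMDiff_smul_left x) 1 fun g => ?_
  have hφ : ∀ g : G, HasMFDerivAt I I' (fun g : G => g • x) g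
      (mfderiv I I' (fun g : G => g • x) g) := fun g =>
    ((contMDiff_smul_left x).mdifferentiableAt (by simp)).hasMFDerivAt
  have h1 : HasMFDerivAt I I (g⁻¹ * ·) g (mfderiv I I (g⁻¹ * ·) g) :=
    ((contMDiff_mul_left (n := ∞)).mdifferentiableAt (by simp)).hasMFDerivAt
  have h3 : HasMFDerivAt I' I' (g • · : M → M) ((g⁻¹ * g) • x)
      (mfderiv I' I' (g • · : M → M) ((g⁻¹ * g) • x)) :=
    ((ContMDiffSMul.contMDiff_const_smul (I := I) (n := ∞) g).mdifferentiableAt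
      (by simp)).hasMFDerivAt
  let A : E →L[ℝ] E := mfderiv I I (g⁻¹ * ·) g
  let C : E' →L[ℝ] E' := mfderiv I' I' (g • · : M → M) ((g⁻¹ * g) • x)
  let B : E →L[ℝ] E' := mfderiv I I' (fun g : G => g • x) (g⁻¹ * g)
  let D : E →L[ℝ] E' := C.comp (B.comp A)
  have h4 : HasMFDerivAt I I' ((g • · : M → M) ∘ (fun g : G => g • x) ∘ (g⁻¹ * ·)) g
      (D) :=
    HasMFDerivAt.comp (g := (g • · : M → M)) g h3
      (HasMFDerivAt.comp (g := fun g : G => g • x) g (hφ (g⁻¹ * g)) h1)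
  have e : (g • · : M → M) ∘ (fun g : G => g • x) ∘ (g⁻¹ * ·) = fun g : G => g • x := by
    ext h
    simp [smul_smul]
  rw [e] at h4
  have h5 : (mfderiv I I' (fun g : G => g • x) g : E →L[ℝ] E') = D := h4.mfderiv
  have hB : ∀ k : G, k = 1 → finrank ℝ (mfderiv I I' (fun g : G => g • x) k : E →L[ℝ] E').range =
      finrank ℝ (mfderiv I I' (fun g : G => g • x) 1 : E →L[ℝ] E').range := by
    rintro k rfl
    rfl
  rw [← hB (g⁻¹ * g) (inv_mul_cancel g), h5]
  change finrank ℝ ((C : E' →ₗ[ℝ] E') ∘ₗ ((B : E →ₗ[ℝ] E') ∘ₗ (A : E →ₗ[ℝ] E))).range ≤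
      finrank ℝ (B : E →ₗ[ℝ] E').range
  rw [LinearMap.range_comp]
  exact (Submodule.finrank_map_le _ _).trans
    (Submodule.finrank_mono (LinearMap.range_comp_le_range _ _))

end Manifolds

section Generators

variable {E : Type*} [NormedAddCommGroup E] [NormedSpace ℝ E] [FiniteDimensional ℝ E]
  {H : Type*} [TopologicalSpace H] {I : ModelWithCorners ℝ E H}
  {M : Type*} [TopologicalSpace M] [ChartedSpace H M] [IsManifold I ∞ M]

/-- A smooth vector field is locally a smooth linear combination of finitely many smooth vector
fields that span the tangent space at the given point. -/
theorem IsSmoothVectorField.exists_local_coefficients {m : ℕ}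
    {X : Fin m → ∀ x : M, TangentSpace I x} (hX : ∀ i, IsSmoothVectorField I (X i))
    {Y : ∀ x : M, TangentSpace I x} (hY : IsSmoothVectorField I Y) {x₀ : M}
    (hspan : ∀ w : TangentSpace I x₀, ∃ c : Fin m → ℝ, w = ∑ i, c i • X i x₀) :
    ∃ U ∈ 𝓝 x₀, ∃ c : M → Fin m → ℝ, ContMDiffOn I 𝓘(ℝ, Fin m → ℝ) ∞ c U ∧
      ∀ x ∈ U, Y x = ∑ i, c x i • X i x := by
  have : IsManifold I 1 M := IsManifold.of_le (n := ∞) (by simp)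
  have : CompleteSpace E := FiniteDimensional.complete ℝ E
  let e := trivializationAt E (TangentSpace I) x₀
  have hx₀ : x₀ ∈ e.baseSet := mem_baseSet_trivializationAt E (TangentSpace I) x₀
  let a : Fin m → M → E := fun i x => (e ⟨x, X i x⟩).2
  let y : M → E := fun x => (e ⟨x, Y x⟩).2
  have ha : ∀ i, ContMDiffOn I 𝓘(ℝ, E) ∞ (a i) e.baseSet := fun i =>
    e.contMDiffOn_section_baseSet_iff.1 (hX i).contMDiffOn
  have hy : ContMDiffOn I 𝓘(ℝ, E) ∞ y e.baseSet :=
    e.contMDiffOn_section_baseSet_iff.1 (ContMDiff.contMDiffOn hY)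
  have hlin : ∀ x ∈ e.baseSet, ∀ c : Fin m → ℝ,
      (e ⟨x, ∑ i, c i • X i x⟩).2 = ∑ i, c i • a i x := by
    intro x hx c
    rw [← e.linearEquivAt_apply (R := ℝ) x hx, map_sum]
    refine Finset.sum_congr rfl fun i _ => ?_
    rw [map_smul, e.linearEquivAt_apply (R := ℝ) x hx]
  let A : M → (Fin m → ℝ) →L[ℝ] E := fun x =>
    ∑ i, (ContinuousLinearMap.proj (R := ℝ) (φ := fun _ : Fin m => ℝ) i).smulRight (a i x)
  have hA : ∀ x c, A x c = ∑ i, c i • a i x := fun x c => by simp [A]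
  have hsurj : Function.Surjective (A x₀) := by
    intro w
    obtain ⟨c, hc⟩ := hspan ((e.linearEquivAt ℝ x₀ hx₀).symm w)
    refine ⟨c, ?_⟩
    rw [hA, ← hlin x₀ hx₀, ← hc, ← e.linearEquivAt_apply (R := ℝ) x₀ hx₀, LinearEquiv.apply_symm_apply]
  obtain ⟨S₀, hS₀⟩ := LinearMap.exists_rightInverse_of_surjective (A x₀ : (Fin m → ℝ) →ₗ[ℝ] E)
    (LinearMap.range_eq_top.2 hsurj)
  let S : E →L[ℝ] (Fin m → ℝ) := LinearMap.toContinuousLinearMap S₀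
  let B : M → E →L[ℝ] E := fun x => (A x).comp S
  have hB : ContMDiffOn I 𝓘(ℝ, E →L[ℝ] E) ∞ B e.baseSet := by
    have hsum : ∀ x, B x = ∑ i, ContinuousLinearMap.smulRightL ℝ E E
        ((ContinuousLinearMap.proj (R := ℝ) (φ := fun _ : Fin m => ℝ) i).comp S) (a i x) := by
      intro x
      ext w
      simp [B, hA]
    simp only [funext hsum]
    refine contMDiffOn_finsetSum fun i _ => ?_
    exact (ContinuousLinearMap.contDiff _).contMDiff.comp_contMDiffOn (ha i)
  have hB₀ : B x₀ = 1 := by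
    ext w
    exact LinearMap.congr_fun hS₀ w
  let U : Set M := e.baseSet ∩ B ⁻¹' {T | IsUnit T}
  have hUo : IsOpen U := hB.continuousOn.isOpen_inter_preimage e.open_baseSet Units.isOpen
  have hU : U ∈ 𝓝 x₀ := hUo.mem_nhds ⟨hx₀, by simp [hB₀]⟩
  refine ⟨U, hU, fun x => S (Ring.inverse (B x) (y x)), ?_, ?_⟩
  · intro x hx
    obtain ⟨u, hu⟩ := hx.2
    have h1 : ContMDiffWithinAt I 𝓘(ℝ, E →L[ℝ] E) ∞ (fun x => Ring.inverse (B x)) U x := by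
      have h2 : ContDiffAt ℝ ∞ Ring.inverse (B x) := hu ▸ contDiffAt_ringInverse ℝ u
      exact h2.contMDiffAt.comp_contMDiffWithinAt x ((hB x hx.1).mono inter_subset_left)
    exact S.contDiff.contMDiff.contMDiffAt.comp_contMDiffWithinAt x
      (h1.clm_apply ((hy x hx.1).mono inter_subset_left))
  · intro x hx
    apply (e.linearEquivAt ℝ x hx.1).injective
    rw [e.linearEquivAt_apply (R := ℝ) x hx.1, e.linearEquivAt_apply (R := ℝ) x hx.1, hlin x hx.1, ← hA]
    change y x = (B x * Ring.inverse (B x)) (y x)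
    rw [Ring.mul_inverse_cancel _ hx.2]
    rfl

/-- Finitely many smooth vector fields which span every tangent space generate the module of smooth
vector fields. -/
theorem IsGeneratingSet.of_forall_span [I.Boundaryless] [T2Space M] [SecondCountableTopology M]
    {m : ℕ} {X : Fin m → ∀ x : M, TangentSpace I x} (hX : ∀ i, IsSmoothVectorField I (X i))
    (hspan : ∀ (x : M) (w : TangentSpace I x), ∃ c : Fin m → ℝ, w = ∑ i, c i • X i x) :
    IsGeneratingSet I X := by
  refine ⟨hX, fun Y hY => ?_⟩
  have : LocallyCompactSpace M := Manifold.locallyCompact_of_finiteDimensional I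
  have hconv : ∀ x : M, Convex ℝ {c : Fin m → ℝ | Y x = ∑ i, c i • X i x} := by
    intro x c hc d hd s t _ _ hst
    simp only [mem_ofPred_eq, Pi.add_apply, Pi.smul_apply, smul_eq_mul] at hc hd ⊢
    simp only [add_smul, mul_smul, Finset.sum_add_distrib, ← Finset.smul_sum]
    rw [← hc, ← hd, ← add_smul, hst, one_smul]
  obtain ⟨g, hg⟩ := exists_contMDiffMap_forall_mem_convex_of_local I (n := (⊤ : ℕ∞)) hconv fun x =>
    IsSmoothVectorField.exists_local_coefficients hX hY (hspan x)
  exact ⟨fun i x => g x i, fun i => (contMDiff_pi_space.1 g.contMDiff) i, hg⟩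

end Generators

section Action

variable {E : Type*} [NormedAddCommGroup E] [NormedSpace ℝ E] [CompleteSpace E]
  {H : Type*} [TopologicalSpace H] {I : ModelWithCorners ℝ E H}
  {E' : Type*} [NormedAddCommGroup E'] [NormedSpace ℝ E']
  {H' : Type*} [TopologicalSpace H'] {I' : ModelWithCorners ℝ E' H'}
  {G : Type*} [TopologicalSpace G] [ChartedSpace H G] [Group G] [LieGroup I ∞ G]
  [BoundarylessManifold I G] [T2Space G]
  {M : Type*} [TopologicalSpace M] [ChartedSpace H' M]
  [MulAction G M] [ContMDiffSMul I I' ∞ G M]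

theorem mdifferentiableAt_lieExp_smul_and_infinitesimalAction_eq (v : GroupLieAlgebra I G) (x : M) :
    MDifferentiableAt 𝓘(ℝ, ℝ) I' (fun t : ℝ => lieExp I (t • v) • x) 0 ∧
      (infinitesimalAction I I' v x : E') =
        (mfderiv I I' (fun g : G => g • x) 1 : E →L[ℝ] E') v := by
  obtain ⟨γ, h0, hγ⟩ := exists_isMIntegralCurve_mulInvariantVectorField v
  have hsub := hγ.isOneParameterSubgroup h0
  have h1 : HasMFDerivAt 𝓘(ℝ, ℝ) I γ 0 (mfderiv 𝓘(ℝ, ℝ) I γ 0) :=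
    (hsub.smooth.mdifferentiableAt (by simp)).hasMFDerivAt
  have h2 : HasMFDerivAt I I' (fun g : G => g • x) (γ 0)
      (mfderiv I I' (fun g : G => g • x) (γ 0)) :=
    ((contMDiff_smul_left x).mdifferentiableAt (by simp)).hasMFDerivAt
  have h3 := HasMFDerivAt.comp (g := fun g : G => g • x) 0 h2 h1
  have e : (fun g : G => g • x) ∘ γ = fun t : ℝ => lieExp I (t • v) • x := by
    ext t
    simp [hsub.lieExp_smul]
  rw [e] at h3
  refine ⟨h3.mdifferentiableAt, ?_⟩
  have h4 : ∀ k : G, k = 1 → (mfderiv I I' (fun g : G => g • x) k : E →L[ℝ] E') v =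
      (mfderiv I I' (fun g : G => g • x) 1 : E →L[ℝ] E') v := by
    rintro k rfl
    rfl
  rw [← h4 (γ 0) h0]
  unfold infinitesimalAction
  rw [h3.mfderiv]
  exact congrArg (mfderiv I I' (fun g : G => g • x) (γ 0) : E →L[ℝ] E') hsub.velocity

theorem isSmoothVectorField_infinitesimalAction [IsManifold I' ∞ M] (v : GroupLieAlgebra I G) :
    IsSmoothVectorField I' (infinitesimalAction I I' v : ∀ x : M, TangentSpace I' x) := by
  have h := contMDiff_mfderiv_partial_left
    (contMDiff_smul (I := I) (I' := I') (n := ∞) (G := G) (M := M)) 1 v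
  unfold IsSmoothVectorField
  convert! h using 2 with x
  refine (tangentBundle_mk_congr I' (one_smul G x).symm _).trans ?_
  exact congrArg (fun w : E' => (TotalSpace.mk (F := E') (E := TangentSpace I') ((1 : G) • x) w))
    (mdifferentiableAt_lieExp_smul_and_infinitesimalAction_eq v x).2

end Action

/-- `G` is a Lie group acting smoothly and transitively on the smooth manifold `M` (both
finite-dimensional, without boundary, Hausdorff and second countable), and `b` is a basis of its Lie
algebra. The curves `t ↦ exp(t bᵢ) • x` are differentiable at `0`, and the vector fields on `M` that
their velocities define form a generating set of the module of smooth vector fields. -/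
theorem mainTheorem7
    {E : Type*} [NormedAddCommGroup E] [NormedSpace ℝ E] [FiniteDimensional ℝ E]
    {H : Type*} [TopologicalSpace H] (I : ModelWithCorners ℝ E H) [I.Boundaryless]
    {E' : Type*} [NormedAddCommGroup E'] [NormedSpace ℝ E'] [FiniteDimensional ℝ E']
    {H' : Type*} [TopologicalSpace H'] (I' : ModelWithCorners ℝ E' H') [I'.Boundaryless]
    (G : Type*) [TopologicalSpace G] [ChartedSpace H G] [Group G] [LieGroup I ∞ G]
    [T2Space G] [SecondCountableTopology G]
    (M : Type*) [TopologicalSpace M] [ChartedSpace H' M] [IsManifold I' ∞ M]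
    [T2Space M] [SecondCountableTopology M]
    [MulAction G M] [ContMDiffSMul I I' ∞ G M] [MulAction.IsPretransitive G M]
    {m : ℕ} (b : Module.Basis (Fin m) ℝ (GroupLieAlgebra I G)) :
    (∀ (i : Fin m) (x : M),
      MDifferentiableAt 𝓘(ℝ, ℝ) I' (fun t : ℝ => lieExp I (t • b i) • x) 0) ∧
    IsGeneratingSet I'
      (fun i : Fin m => (infinitesimalAction I I' (b i) : ∀ x : M, TangentSpace I' x)) := by
  have : CompleteSpace E := FiniteDimensional.complete ℝ E
  refine ⟨fun i x => (mdifferentiableAt_lieExp_smul_and_infinitesimalAction_eq (b i) x).1,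
    IsGeneratingSet.of_forall_span (fun i => isSmoothVectorField_infinitesimalAction (b i))
      fun x w => ?_⟩
  let D : E →L[ℝ] E' := mfderiv I I' (fun g : G => g • x) (1 : G)
  obtain ⟨v, hv⟩ : ∃ v : E, D v = w := mfderiv_smul_left_surjective x w
  let b' : Module.Basis (Fin m) ℝ E := b
  refine ⟨b'.repr v, ?_⟩
  have h1 : D v = ∑ i, b'.repr v i • D (b' i) :=
    (congrArg D (b'.sum_repr v).symm).trans (by simp only [map_sum, map_smul])
  refine (hv.symm.trans h1).trans (Finset.sum_congr rfl fun i _ => ?_)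
  exact congrArg (fun w : E' => b'.repr v i • w)
    (mdifferentiableAt_lieExp_smul_and_infinitesimalAction_eq (b i) x).2.symm
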